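/- Let $S\subset\mathbf{R}^3$ be an (embedded) $C^\infty$ surface with boundary $\gamma=\partial S$, and put $\mathrm{Int}\,S=S\setminus\gamma$. Let $\widetilde S\subset\mathbf{R}^3$ be a flat $C^1$ extension of $S$, that is, an (embedded) $C^1$ surface without boundary such that $S\subset\widetilde S$, the set $S'=\widetilde S\setminus\mathrm{Int}\,S$ is a $C^\infty$ surface with boundary, and the Gaussian curvature of $S'$ vanishes identically. Suppose that the restriction $g|_\gamma$ to $\gamma$ of the (locally defined, up to sign) Gauss map $g$ of $S$ with values in $S^2$ is an immersion. Regard $\mathbf{R}^3$ as a subset of $\mathbf{R}P^3$ by $x\mapsto[1:x]$, let $I=\{([X],[Y])\in\mathbf{R}P^3\times\mathbf{R}P^{3*}\mid Y(X)=0\}$ be the incidence manifold, and let $\pi_1:I\to\mathbf{R}P^3$ and $\pi_2:I\to\mathbf{R}P^{3*}$ be the projections. The Legendre lift of a surface $M\subset\mathbf{R}^3$ (with or without boundary) is the set of all $([X],[Y])\in I$ such that $[X]\in M$ and the projective plane $\ker Y$ is the projective closure of the affine tangent plane of $M$ at $[X]$. Let $\Gamma$ be the part of the Legendre lift of $S$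 that lies over $\gamma$, and let $\widehat\gamma=\pi_2(\Gamma)\subset\mathbf{R}P^{3*}$ be the dual-boundary. Then every $p\in\gamma$ has an open neighbourhood $U$ in $S'=\widetilde S\setminus\mathrm{Int}\,S$ whose Legendre lift $L_U$ projects by $\pi_2$ into the dual-boundary, $\pi_2(L_U)\subset\widehat\gamma$; more precisely, $U$ can be chosen so that $\pi_2$ maps $L_U$ onto the part of $\widehat\gamma$ over $U\cap\gamma$, i.e. $\pi_2(L_U)=\pi_2(\Gamma\cap\pi_1^{-1}(U))$. -/

import Mathlib

open scoped ContDiff LinearAlgebra.Projectivization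

noncomputable section

namespace FlatExtension

/-- Euclidean `3`-space. -/
abbrev E3 : Type := EuclideanSpace ℝ (Fin 3)

/-! ### Surfaces in Euclidean space -/

/-- `Φ` is a local diffeomorphism of class `C^n` between open subsets of `ℝ³`. -/
def IsDiffeoOn (n : WithTop ℕ∞) (Φ : OpenPartialHomeomorph E3 E3) : Prop :=
  ContDiffOn ℝ n Φ Φ.source ∧ ContDiffOn ℝ n Φ.symm Φ.target

/-- `Φ` straightens `M` to the coordinate plane `{y₂ = 0}`. -/
def IsPlaneChart (n : WithTop ℕ∞) (M : Set E3) (Φ : OpenPartialHomeomorph E3 E3) : Prop :=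
  IsDiffeoOn n Φ ∧ ∀ x ∈ Φ.source, x ∈ M ↔ Φ x 2 = 0

/-- `Φ` straightens `M` to the coordinate half-plane `{y₂ = 0, y₁ ≥ 0}`. -/
def IsHalfPlaneChart (n : WithTop ℕ∞) (M : Set E3) (Φ : OpenPartialHomeomorph E3 E3) : Prop :=
  IsDiffeoOn n Φ ∧ ∀ x ∈ Φ.source, x ∈ M ↔ (Φ x 2 = 0 ∧ 0 ≤ Φ x 1)

/-- `M` is an (embedded) surface of class `C^n` without boundary in `ℝ³`. -/
def IsSurface (n : WithTop ℕ∞) (M : Set E3) : Prop :=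
  ∀ p ∈ M, ∃ Φ : OpenPartialHomeomorph E3 E3, p ∈ Φ.source ∧ IsPlaneChart n M Φ

/-- `M` is an (embedded) `C^∞` surface with boundary in `ℝ³`. The boundary may be empty:
an interior point is one that a half-plane chart sends into the open half-plane `{y₁ > 0}`. -/
def IsSurfaceWithBoundary (M : Set E3) : Prop :=
  ∀ p ∈ M, ∃ Φ : OpenPartialHomeomorph E3 E3, p ∈ Φ.source ∧ IsHalfPlaneChart ∞ M Φ

/-- The boundary of a `C^∞` surface with boundary. -/
def boundary (M : Set E3) : Set E3 :=
  {p | p ∈ M ∧ ∃ Φ : OpenPartialHomeomorph E3 E3,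
    p ∈ Φ.source ∧ IsHalfPlaneChart ∞ M Φ ∧ Φ p 1 = 0}

/-- The interior `Int M` of a `C^∞` surface with boundary. -/
def surfaceInterior (M : Set E3) : Set E3 := M \ boundary M

/-- The tangent space of `M` at `x` as a linear subspace of `ℝ³`. At a boundary point of a
surface with boundary it is the full tangent plane; for a curve it is the tangent line. -/
def tangentSpace (M : Set E3) (x : E3) : Submodule ℝ E3 :=
  Submodule.span ℝ (tangentConeAt ℝ M x)

/-! ### Gauss map and Gaussian curvature -/

/-- On the open set `W`, the map `N` is (a `C^∞` extension to `W` of) a choice of the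
Gauss map `M ∩ W → S²`, i.e. of a unit normal field of `M`. -/
def IsGaussMapOn (M W : Set E3) (N : E3 → E3) : Prop :=
  ContDiffOn ℝ ∞ N W ∧
    ∀ x ∈ M ∩ W, ‖N x‖ = 1 ∧ ∀ v ∈ tangentSpace M x, inner ℝ (N x) v = 0

/-- The differential at `x` of the Gauss map `N` of `M`, as an endomorphism of `T_x M`
(the negative of the shape operator). Only the restriction of `N` to `M` matters, and for a unit
normal field the derivative maps `T_x M` to itself, so the projection changes nothing. -/
def gaussDifferential (M : Set E3) (N : E3 → E3) (x : E3) :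
    tangentSpace M x →ₗ[ℝ] tangentSpace M x :=
  ((tangentSpace M x).orthogonalProjectionOnto ∘L
    (fderiv ℝ N x ∘L (tangentSpace M x).subtypeL)).toLinearMap

/-- The Gaussian curvature at `x` of a surface `M` with Gauss map `N` near `x`. It does
not change if `N` is replaced by `-N`. -/
def gaussianCurvature (M : Set E3) (N : E3 → E3) (x : E3) : ℝ :=
  LinearMap.det (gaussDifferential M N x)

/-- The Gaussian curvature of `M` vanishes identically. -/
def IsFlat (M : Set E3) : Prop :=
  ∀ p ∈ M, ∃ (W : Set E3) (N : E3 → E3), IsOpen W ∧ p ∈ W ∧ IsGaussMapOn M W N ∧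
    ∀ x ∈ M ∩ W, gaussianCurvature M N x = 0

/-- The Gauss map of `M`, restricted to the curve `c ⊆ M`, is an immersion. -/
def GaussMapImmersiveAlong (M c : Set E3) : Prop :=
  ∀ p ∈ c, ∃ (W : Set E3) (N : E3 → E3), IsOpen W ∧ p ∈ W ∧ IsGaussMapOn M W N ∧
    ∀ v ∈ tangentSpace c p, v ≠ 0 → fderiv ℝ N p v ≠ 0

/-- `T` is a flat `C¹` extension of the surface with boundary `S`. -/
structure IsFlatC1Extension (S T : Set E3) : Prop where
  surface : IsSurface 1 T
  subset : S ⊆ T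
  smooth : IsSurfaceWithBoundary (T \ surfaceInterior S)
  flat : IsFlat (T \ surfaceInterior S)

/-! ### Projective duality -/

/-- The projective space `ℝP³`, in homogeneous coordinates `[X₀ : X]` with `X₀ ∈ ℝ`, `X ∈ ℝ³`. -/
abbrev RP3 : Type := ℙ ℝ (ℝ × E3)

/-- The dual projective space `ℝP³*`. -/
abbrev RP3Dual : Type := ℙ ℝ (Module.Dual ℝ (ℝ × E3))

/-- The incidence manifold `I⁵ = {([X], [Y]) | Y(X) = 0}`. -/
abbrev Incidence : Type := {z : RP3 × RP3Dual // z.2.rep z.1.rep = 0}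

/-- The projection `I⁵ → ℝP³`. -/
def proj₁ (z : Incidence) : RP3 := z.1.1

/-- The projection `I⁵ → ℝP³*`. -/
def proj₂ (z : Incidence) : RP3Dual := z.1.2

/-- The standard embedding `ℝ³ → ℝP³`, `x ↦ [1 : x]`. -/
def affinePoint (x : E3) : RP3 :=
  Projectivization.mk ℝ ((1 : ℝ), x) (fun h => one_ne_zero (congrArg Prod.fst h))

/-- The linear subspace of `ℝ × ℝ³` whose projectivization is the projective closure of the
affine tangent plane `x + T_x M`. -/
def projectiveTangentSpace (M : Set E3) (x : E3) : Submodule ℝ (ℝ × E3) :=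
  Submodule.span ℝ {((1 : ℝ), x)} ⊔ (tangentSpace M x).map (LinearMap.inr ℝ ℝ E3)

/-- The Legendre lift of `M`: the pairs of a point of `M` and the projective tangent plane there. -/
def legendreLift (M : Set E3) : Set Incidence :=
  {z | ∃ x ∈ M, proj₁ z = affinePoint x ∧
    LinearMap.ker (proj₂ z).rep = projectiveTangentSpace M x}

/-- The boundary `Γ` of the Legendre lift `L` of a surface with boundary. -/
def boundaryLift (M : Set E3) : Set Incidence :=
  {z | z ∈ legendreLift M ∧ proj₁ z ∈ affinePoint '' boundary M}

/-- The dual-boundary: the image of `Γ` in the dual projective space. -/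
def dualBoundary (M : Set E3) : Set RP3Dual := proj₂ '' boundaryLift M

end FlatExtension

end

/-!
Let `M = T \ surfaceInterior S`, with unit normal field `N` near `p ∈ boundary S`. Both `S` and `M`
lie in the `C¹` surface `T`, so along their common boundary they have the same tangent planes, their
unit normals are parallel, and `N` is immersive along `boundary M`. Hence in a chart `(y₀, y₁, y₂)`
flattening `M` to `{y₂ = 0, y₁ ≥ 0}` the coordinate `y₀` may be replaced by `⟨w, N⟩`, where `w` is
the derivative of `N` along the boundary. Vanishing curvature gives a nonzero tangent vector in the
kernel of `dN`; it also kills `y₀ = ⟨w, N⟩`, so it is a multiple of `∂/∂y₁`. Therefore `N`, and with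
it the height `⟨N, x⟩`, is constant along the lines on which only `y₁` varies. Each such line runs
back to the boundary and carries a single tangent plane, which is a tangent plane of `S` there.
-/

open Set Filter Topology

namespace FlatExtension

section Calculus

variable {E F : Type*} [NormedAddCommGroup E] [NormedSpace ℝ E]
  [NormedAddCommGroup F] [NormedSpace ℝ F]

theorem tendsto_line (a w : E) : Tendsto (fun t : ℝ => a + t • w) (𝓝[>] 0) (𝓝 a) := by
  have hcont : Continuous fun t : ℝ => a + t • w := by fun_prop
  simpa using (hcont.tendsto 0).mono_left nhdsWithin_le_nhds

theorem mem_posTangentConeAt_of_hasDerivWithinAt {s : Set E} {c : ℝ → E} {v : E} {a : ℝ}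
    (hc : HasDerivWithinAt c v (Ioi a) a) (hs : ∃ᶠ t in 𝓝[>] a, c t ∈ s) :
    v ∈ posTangentConeAt s (c a) := by
  have hone : (1 : ℝ) ∈ posTangentConeAt (c ⁻¹' s ∩ Ioi a) a :=
    one_mem_posTangentConeAt_iff_frequently.2 (hs.and_eventually self_mem_nhdsWithin)
  obtain ⟨ι, l, hl, k, d, hd, hds, hkd⟩ := exists_fun_of_mem_tangentConeAt hone
  have hd' : Tendsto (fun n => a + d n) l (𝓝[>] a) :=
    tendsto_nhdsWithin_iff.2 ⟨by simpa using tendsto_const_nhds.add hd, hds.mono fun n hn => hn.2⟩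
  refine mem_tangentConeAt_of_seq l k (fun n => c (a + d n) - c a) ?_ ?_ ?_
  · simpa using (hc.continuousWithinAt.tendsto.comp hd').sub_const (c a)
  · filter_upwards [hds] with n hn
    simpa using hn.1
  · simpa [NNReal.smul_def] using hc.hasFDerivWithinAt.lim (c := fun n => (k n : ℝ)) hd
      (hds.mono fun n hn => hn.2) hkd

theorem fderiv_apply_eq_of_eventuallyEq_nhdsWithin {s : Set E} {x v : E} {f g : E → F}
    {f' g' : E →L[ℝ] F} (hf : HasFDerivAt f f' x) (hg : HasFDerivAt g g' x)
    (hfg : f =ᶠ[𝓝[s] x] g) (hx : x ∈ s) (hv : v ∈ Submodule.span ℝ (tangentConeAt ℝ s x)) :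
    f' v = g' v := by
  have hEqOn : EqOn f' g' (tangentConeAt ℝ s x) :=
    hf.hasFDerivWithinAt.unique_on
      (hg.hasFDerivWithinAt.congr_of_eventuallyEq hfg (hfg.self_of_nhdsWithin hx))
  exact LinearMap.eqOn_span (f := f'.toLinearMap) (g := g'.toLinearMap) hEqOn hv

end Calculus

section InnerProduct

variable {E F : Type*} [NormedAddCommGroup E] [NormedSpace ℝ E]
  [NormedAddCommGroup F] [InnerProductSpace ℝ F]

theorem inner_fderiv_apply_eq_zero_of_norm_eq {s : Set E} {x v : E} {a : E → F} {a' : E →L[ℝ] F}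
    {r : ℝ} (ha : HasFDerivAt a a' x) (hr : ∀ᶠ y in 𝓝[s] x, ‖a y‖ = r) (hx : x ∈ s)
    (hv : v ∈ Submodule.span ℝ (tangentConeAt ℝ s x)) : inner ℝ (a x) (a' v) = 0 := by
  have h := fderiv_apply_eq_of_eventuallyEq_nhdsWithin ha.norm_sq (hasFDerivAt_const (r ^ 2) x)
    (hr.mono fun y hy => by simp [hy]) hx hv
  simpa using h

theorem eq_inner_smul_of_mem_span_singleton {a b : F} (hb : ‖b‖ = 1)
    (hab : a ∈ Submodule.span ℝ {b}) : a = inner ℝ b a • b := by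
  obtain ⟨r, rfl⟩ := Submodule.mem_span_singleton.1 hab
  simp [inner_smul_right, hb]

theorem fderiv_apply_eq_zero_of_mem_span_singleton {s : Set E} {x v : E} {a b : E → F}
    {a' b' : E →L[ℝ] F} (ha : HasFDerivAt a a' x) (hb : HasFDerivAt b b' x)
    (ha1 : ∀ᶠ y in 𝓝[s] x, ‖a y‖ = 1) (hb1 : ∀ᶠ y in 𝓝[s] x, ‖b y‖ = 1)
    (hab : ∀ᶠ y in 𝓝[s] x, a y ∈ Submodule.span ℝ {b y}) (hx : x ∈ s)
    (hv : v ∈ Submodule.span ℝ (tangentConeAt ℝ s x)) (hbv : b' v = 0) : a' v = 0 := by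
  have hdecomp : ∀ᶠ y in 𝓝[s] x, a y = inner ℝ (b y) (a y) • b y := by
    filter_upwards [hb1, hab] with y hy hmem using eq_inner_smul_of_mem_span_singleton hy hmem
  have hax : a x = inner ℝ (b x) (a x) • b x := hdecomp.self_of_nhdsWithin hx
  have ha'v : a' v = inner ℝ (b x) (a' v) • b x := by
    simpa [hbv] using
      fderiv_apply_eq_of_eventuallyEq_nhdsWithin ha ((hb.inner ℝ ha).smul hb) hdecomp hx hv
  have horth : inner ℝ (a x) (a' v) = 0 := inner_fderiv_apply_eq_zero_of_norm_eq ha ha1 hx hv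
  have hcoef : inner ℝ (b x) (a x) * inner ℝ (b x) (a' v) = 0 := by
    rwa [hax, inner_smul_left] at horth
  have hne : inner ℝ (b x) (a x) ≠ 0 := fun h => by
    have hnorm : ‖a x‖ = 1 := ha1.self_of_nhdsWithin hx
    rw [hax, h] at hnorm
    simp at hnorm
  rw [ha'v, (mul_eq_zero.1 hcoef).resolve_left hne, zero_smul]

theorem eq_orthogonal_span_singleton {n : ℕ} (hF : Module.finrank ℝ F = n + 1)
    {V : Submodule ℝ F} (hV : Module.finrank ℝ V = n) {e : F} (he : e ≠ 0)
    (h : ∀ v ∈ V, inner ℝ e v = 0) : V = (Submodule.span ℝ {e})ᗮ := by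
  have : Fact (Module.finrank ℝ F = n + 1) := ⟨hF⟩
  have : FiniteDimensional ℝ F := .of_fact_finrank_eq_succ (K := ℝ) n
  refine Submodule.eq_of_le_of_finrank_eq
    (fun v hv => Submodule.mem_orthogonal_singleton_iff_inner_right.2 (h v hv)) ?_
  rw [hV, Submodule.finrank_orthogonal_span_singleton (n := n) he]

end InnerProduct

section TangentSpace

variable {M M' : Set E3} {x : E3}

theorem tangentSpace_mono (h : M ⊆ M') (x : E3) : tangentSpace M x ≤ tangentSpace M' x :=
  Submodule.span_mono (tangentConeAt_mono h)

theorem tangentSpace_congr (h : 𝓝[M] x = 𝓝[M'] x) : tangentSpace M x = tangentSpace M' x := by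
  rw [tangentSpace, tangentSpace, tangentConeAt_congr h]

theorem posTangentConeAt_subset_tangentSpace (M : Set E3) (x : E3) :
    posTangentConeAt M x ⊆ tangentSpace M x :=
  tangentConeAt_mono_field.trans Submodule.subset_span

end TangentSpace

section LocalDiffeomorphism

variable {n : WithTop ℕ∞} {M : Set E3} {Φ : OpenPartialHomeomorph E3 E3} {x : E3}

theorem IsDiffeoOn.of_le {m : WithTop ℕ∞} (h : IsDiffeoOn n Φ) (hmn : m ≤ n) : IsDiffeoOn m Φ :=
  ⟨h.1.of_le hmn, h.2.of_le hmn⟩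

theorem IsDiffeoOn.contDiffAt (h : IsDiffeoOn n Φ) (hx : x ∈ Φ.source) : ContDiffAt ℝ n Φ x :=
  h.1.contDiffAt (Φ.open_source.mem_nhds hx)

theorem IsDiffeoOn.contDiffAt_symm (h : IsDiffeoOn n Φ) (hx : x ∈ Φ.source) :
    ContDiffAt ℝ n Φ.symm (Φ x) :=
  h.2.contDiffAt (Φ.open_target.mem_nhds (Φ.map_source hx))

theorem IsDiffeoOn.hasFDerivAt (h : IsDiffeoOn 1 Φ) (hx : x ∈ Φ.source) :
    HasFDerivAt Φ (fderiv ℝ Φ x) x :=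
  ((h.contDiffAt hx).differentiableAt one_ne_zero).hasFDerivAt

theorem IsDiffeoOn.hasFDerivAt_symm (h : IsDiffeoOn 1 Φ) (hx : x ∈ Φ.source) :
    HasFDerivAt Φ.symm (fderiv ℝ Φ.symm (Φ x)) (Φ x) :=
  ((h.contDiffAt_symm hx).differentiableAt one_ne_zero).hasFDerivAt

theorem IsDiffeoOn.fderiv_symm_apply_fderiv_apply (h : IsDiffeoOn 1 Φ) (hx : x ∈ Φ.source)
    (v : E3) : fderiv ℝ Φ.symm (Φ x) (fderiv ℝ Φ x v) = v := by
  have hcomp : fderiv ℝ Φ.symm (Φ x) ∘L fderiv ℝ Φ x = .id ℝ E3 :=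
    ((h.hasFDerivAt_symm hx).comp x (h.hasFDerivAt hx)).unique
      ((hasFDerivAt_id x).congr_of_eventuallyEq (Φ.eventually_left_inverse hx))
  exact DFunLike.congr_fun hcomp v

theorem IsDiffeoOn.fderiv_apply_fderiv_symm_apply (h : IsDiffeoOn 1 Φ) (hx : x ∈ Φ.source)
    (v : E3) : fderiv ℝ Φ x (fderiv ℝ Φ.symm (Φ x) v) = v := by
  have hd : HasFDerivAt Φ (fderiv ℝ Φ x) (Φ.symm (Φ x)) := by
    simpa only [Φ.left_inv hx] using h.hasFDerivAt hx
  have hcomp : fderiv ℝ Φ x ∘L fderiv ℝ Φ.symm (Φ x) = .id ℝ E3 :=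
    (hd.comp (Φ x) (h.hasFDerivAt_symm hx)).unique
      ((hasFDerivAt_id (Φ x)).congr_of_eventuallyEq
        (Φ.eventually_right_inverse (Φ.map_source hx)))
  exact DFunLike.congr_fun hcomp v

theorem hasFDerivAt_coord {f : E3 → E3} {f' : E3 →L[ℝ] E3} (h : HasFDerivAt f f' x) (i : Fin 3) :
    HasFDerivAt (fun y => f y i) (EuclideanSpace.proj i ∘L f') x :=
  (EuclideanSpace.proj (𝕜 := ℝ) i).hasFDerivAt.comp x h

/-- The coordinate vector field `∂/∂yᵢ` of the local coordinates `y = Φ` on `ℝ³`. -/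
noncomputable def coordVec (Φ : OpenPartialHomeomorph E3 E3) (x : E3) (i : Fin 3) : E3 :=
  fderiv ℝ Φ.symm (Φ x) (EuclideanSpace.single i 1)

theorem IsDiffeoOn.fderiv_coordVec (h : IsDiffeoOn 1 Φ) (hx : x ∈ Φ.source) (i : Fin 3) :
    fderiv ℝ Φ x (coordVec Φ x i) = EuclideanSpace.single i 1 :=
  h.fderiv_apply_fderiv_symm_apply hx _

theorem IsDiffeoOn.sum_smul_coordVec (h : IsDiffeoOn 1 Φ) (hx : x ∈ Φ.source) (v : E3) :
    ∑ i, fderiv ℝ Φ x v i • coordVec Φ x i = v := by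
  conv_rhs => rw [← h.fderiv_symm_apply_fderiv_apply hx v,
    ← (EuclideanSpace.basisFun (Fin 3) ℝ).sum_repr (fderiv ℝ Φ x v), map_sum]
  simp [coordVec]

theorem eventually_line_mem_target (hx : x ∈ Φ.source) (w : E3) :
    ∀ᶠ t : ℝ in 𝓝[>] 0, Φ x + t • w ∈ Φ.target :=
  (tendsto_line (Φ x) w).eventually_mem (Φ.open_target.mem_nhds (Φ.map_source hx))

theorem IsDiffeoOn.fderiv_symm_mem_posTangentConeAt (h : IsDiffeoOn 1 Φ) (hx : x ∈ Φ.source)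
    {w : E3} (hM : ∀ᶠ t : ℝ in 𝓝[>] 0, ∀ y ∈ Φ.source, Φ y = Φ x + t • w → y ∈ M) :
    fderiv ℝ Φ.symm (Φ x) w ∈ posTangentConeAt M x := by
  have hline : HasDerivAt (fun t : ℝ => Φ x + t • w) w 0 := by
    simpa using ((hasDerivAt_id (0 : ℝ)).smul_const w).const_add (Φ x)
  have hcurve : HasDerivAt (fun t : ℝ => Φ.symm (Φ x + t • w)) (fderiv ℝ Φ.symm (Φ x) w) 0 := by
    refine HasFDerivAt.comp_hasDerivAt (0 : ℝ) ?_ hline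
    simpa using h.hasFDerivAt_symm hx
  have hmem : ∀ᶠ t : ℝ in 𝓝[>] 0, Φ.symm (Φ x + t • w) ∈ M := by
    filter_upwards [hM, eventually_line_mem_target hx w]
      with t ht htt using ht _ (Φ.map_target htt) (Φ.right_inv htt)
  simpa [Φ.left_inv hx] using
    mem_posTangentConeAt_of_hasDerivWithinAt hcurve.hasDerivWithinAt hmem.frequently

end LocalDiffeomorphism

section Charts

variable {n : WithTop ℕ∞} {M T : Set E3} {Φ : OpenPartialHomeomorph E3 E3} {x : E3}

theorem IsHalfPlaneChart.of_le {m : WithTop ℕ∞} (h : IsHalfPlaneChart n M Φ) (hmn : m ≤ n) :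
    IsHalfPlaneChart m M Φ :=
  ⟨h.1.of_le hmn, h.2⟩

theorem IsHalfPlaneChart.fderiv_symm_mem_posTangentConeAt (h : IsHalfPlaneChart 1 M Φ)
    (hx : x ∈ Φ.source) (hxM : x ∈ M) {w : E3} (hw2 : w 2 = 0) (hw1 : 0 ≤ w 1 ∨ 0 < Φ x 1) :
    fderiv ℝ Φ.symm (Φ x) w ∈ posTangentConeAt M x := by
  obtain ⟨hx2, hx1⟩ := (h.2 x hx).1 hxM
  have hnonneg : ∀ᶠ t : ℝ in 𝓝[>] 0, 0 ≤ Φ x 1 + t * w 1 := by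
    rcases hw1 with hw1 | hpos
    · filter_upwards [self_mem_nhdsWithin] with t (ht : 0 < t)
      positivity
    · have hcont : ContinuousAt (fun t : ℝ => Φ x 1 + t * w 1) 0 := by fun_prop
      exact nhdsWithin_le_nhds ((hcont.eventually_const_lt (by simpa using hpos)).mono
        fun t => le_of_lt)
  refine h.1.fderiv_symm_mem_posTangentConeAt hx ?_
  filter_upwards [hnonneg] with t ht y hy hty
  exact (h.2 y hy).2 (by simpa [hty, hx2, hw2] using ht)

theorem IsPlaneChart.fderiv_symm_mem_posTangentConeAt (h : IsPlaneChart 1 M Φ)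
    (hx : x ∈ Φ.source) (hxM : x ∈ M) {w : E3} (hw2 : w 2 = 0) :
    fderiv ℝ Φ.symm (Φ x) w ∈ posTangentConeAt M x :=
  h.1.fderiv_symm_mem_posTangentConeAt hx <| .of_forall fun t y hy hty =>
    (h.2 y hy).2 (by simp [hty, (h.2 x hx).1 hxM, hw2])

theorem IsDiffeoOn.fderiv_apply_two_eq_zero (h : IsDiffeoOn 1 Φ) (hx : x ∈ Φ.source)
    (hxM : x ∈ M) (hM : ∀ y ∈ Φ.source, y ∈ M → Φ y 2 = 0) {v : E3} (hv : v ∈ tangentSpace M x) :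
    fderiv ℝ Φ x v 2 = 0 := by
  have hzero : (fun y => Φ y 2) =ᶠ[𝓝[M] x] fun _ => (0 : ℝ) := by
    filter_upwards [self_mem_nhdsWithin, nhdsWithin_le_nhds (Φ.open_source.mem_nhds hx)]
      with y hyM hy using hM y hy hyM
  simpa using fderiv_apply_eq_of_eventuallyEq_nhdsWithin (hasFDerivAt_coord (h.hasFDerivAt hx) 2)
    (hasFDerivAt_const (0 : ℝ) x) hzero hxM hv

theorem IsPlaneChart.mem_tangentSpace_iff (h : IsPlaneChart 1 M Φ) (hx : x ∈ Φ.source)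
    (hxM : x ∈ M) {v : E3} : v ∈ tangentSpace M x ↔ fderiv ℝ Φ x v 2 = 0 := by
  refine ⟨h.1.fderiv_apply_two_eq_zero hx hxM fun y hy => (h.2 y hy).1, fun hv => ?_⟩
  rw [← h.1.fderiv_symm_apply_fderiv_apply hx v]
  exact posTangentConeAt_subset_tangentSpace M x (h.fderiv_symm_mem_posTangentConeAt hx hxM hv)

theorem IsHalfPlaneChart.mem_tangentSpace_iff (h : IsHalfPlaneChart 1 M Φ) (hx : x ∈ Φ.source)
    (hxM : x ∈ M) {v : E3} : v ∈ tangentSpace M x ↔ fderiv ℝ Φ x v 2 = 0 := by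
  have hinward : ∀ {w : E3}, w 2 = 0 → 0 ≤ w 1 → fderiv ℝ Φ.symm (Φ x) w ∈ tangentSpace M x :=
    fun hw2 hw1 => posTangentConeAt_subset_tangentSpace M x
      (h.fderiv_symm_mem_posTangentConeAt hx hxM hw2 (.inl hw1))
  refine ⟨h.1.fderiv_apply_two_eq_zero hx hxM fun y hy hyM => ((h.2 y hy).1 hyM).1, fun hv => ?_⟩
  rw [← h.1.fderiv_symm_apply_fderiv_apply hx v]
  rcases le_total 0 (fderiv ℝ Φ x v 1) with hv1 | hv1
  · exact hinward hv hv1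
  · have hneg := hinward (w := -fderiv ℝ Φ x v) (by simp [hv]) (by simpa using hv1)
    simpa only [map_neg, neg_mem_iff] using hneg

theorem IsDiffeoOn.finrank_eq_two (h : IsDiffeoOn 1 Φ) (hx : x ∈ Φ.source) {V : Submodule ℝ E3}
    (hV : ∀ v, v ∈ V ↔ fderiv ℝ Φ x v 2 = 0) : Module.finrank ℝ V = 2 := by
  let f : Module.Dual ℝ E3 := (EuclideanSpace.proj (𝕜 := ℝ) 2 ∘L fderiv ℝ Φ x).toLinearMap
  have hf : f ≠ 0 := fun h0 => by
    have h1 := LinearMap.congr_fun h0 (coordVec Φ x 2)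
    simp [f, h.fderiv_coordVec hx] at h1
  have hker : V = f.ker := Submodule.ext hV
  have hrank := Module.Dual.finrank_ker_add_one_of_ne_zero hf
  rw [finrank_euclideanSpace_fin, ← hker] at hrank
  omega

theorem IsHalfPlaneChart.finrank_tangentSpace (h : IsHalfPlaneChart 1 M Φ) (hx : x ∈ Φ.source)
    (hxM : x ∈ M) : Module.finrank ℝ (tangentSpace M x) = 2 :=
  h.1.finrank_eq_two hx fun _ => h.mem_tangentSpace_iff hx hxM

theorem IsSurface.finrank_tangentSpace (hT : IsSurface 1 T) (hx : x ∈ T) :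
    Module.finrank ℝ (tangentSpace T x) = 2 := by
  obtain ⟨Ψ, hxΨ, hΨ⟩ := hT x hx
  exact hΨ.1.finrank_eq_two hxΨ fun _ => hΨ.mem_tangentSpace_iff hxΨ hx

theorem IsHalfPlaneChart.tangentSpace_eq (h : IsHalfPlaneChart 1 M Φ) (hx : x ∈ Φ.source)
    (hxM : x ∈ M) (hT : IsSurface 1 T) (hMT : M ⊆ T) : tangentSpace M x = tangentSpace T x :=
  Submodule.eq_of_le_of_finrank_eq (tangentSpace_mono hMT x)
    ((h.finrank_tangentSpace hx hxM).trans (hT.finrank_tangentSpace (hMT hxM)).symm)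

theorem IsSurfaceWithBoundary.exists_chart (hM : IsSurfaceWithBoundary M) (hx : x ∈ M) :
    ∃ Φ : OpenPartialHomeomorph E3 E3, x ∈ Φ.source ∧ IsHalfPlaneChart 1 M Φ := by
  obtain ⟨Φ, hxΦ, hΦ⟩ := hM x hx
  exact ⟨Φ, hxΦ, hΦ.of_le (by simp)⟩

theorem exists_chart_of_mem_boundary (hx : x ∈ boundary M) :
    ∃ Φ : OpenPartialHomeomorph E3 E3, x ∈ Φ.source ∧ IsHalfPlaneChart 1 M Φ ∧ Φ x 1 = 0 := by
  obtain ⟨-, Φ, hxΦ, hΦ, h0⟩ := hx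
  exact ⟨Φ, hxΦ, hΦ.of_le (by simp), h0⟩

end Charts

section Boundary

variable {M M' T : Set E3} {Φ : OpenPartialHomeomorph E3 E3} {x : E3}

/-- Every tangent vector of `M` at `x` is a one-sided tangent direction of `M`. For a surface with
boundary this singles out the interior points, without reference to a chart. -/
def HasLinearTangentCone (M : Set E3) (x : E3) : Prop :=
  (tangentSpace M x : Set E3) ⊆ posTangentConeAt M x

theorem hasLinearTangentCone_congr (h : 𝓝[M] x = 𝓝[M'] x) :
    HasLinearTangentCone M x ↔ HasLinearTangentCone M' x := by
  rw [HasLinearTangentCone, HasLinearTangentCone, tangentSpace_congr h, posTangentConeAt,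
    posTangentConeAt, tangentConeAt_congr h]

theorem IsSurface.hasLinearTangentCone (hT : IsSurface 1 T) (hx : x ∈ T) :
    HasLinearTangentCone T x := fun v hv => by
  obtain ⟨Ψ, hxΨ, hΨ⟩ := hT x hx
  rw [← hΨ.1.fderiv_symm_apply_fderiv_apply hxΨ v]
  exact hΨ.fderiv_symm_mem_posTangentConeAt hxΨ hx ((hΨ.mem_tangentSpace_iff hxΨ hx).1 hv)

theorem IsHalfPlaneChart.hasLinearTangentCone_iff (h : IsHalfPlaneChart 1 M Φ)
    (hx : x ∈ Φ.source) (hxM : x ∈ M) : HasLinearTangentCone M x ↔ 0 < Φ x 1 := by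
  refine ⟨fun hlin => ((h.2 x hx).1 hxM).2.lt_of_ne fun h0 => ?_, fun hpos v hv => ?_⟩
  · have hmin : IsLocalMinOn (fun y => Φ y 1) M x := by
      filter_upwards [self_mem_nhdsWithin, nhdsWithin_le_nhds (Φ.open_source.mem_nhds hx)]
        with y hyM hy using h0 ▸ ((h.2 y hy).1 hyM).2
    have htan : -coordVec Φ x 1 ∈ tangentSpace M x :=
      (h.mem_tangentSpace_iff hx hxM).2 (by simp [h.1.fderiv_coordVec hx])
    have hnonneg := hmin.hasFDerivWithinAt_nonneg
      (hasFDerivAt_coord (h.1.hasFDerivAt hx) 1).hasFDerivWithinAt (hlin htan)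
    norm_num [h.1.fderiv_coordVec hx] at hnonneg
  · rw [← h.1.fderiv_symm_apply_fderiv_apply hx v]
    exact h.fderiv_symm_mem_posTangentConeAt hx hxM ((h.mem_tangentSpace_iff hx hxM).1 hv)
      (.inr hpos)

theorem not_hasLinearTangentCone_of_mem_boundary (hx : x ∈ boundary M) :
    ¬HasLinearTangentCone M x := by
  obtain ⟨Φ, hxΦ, hΦ, h0⟩ := exists_chart_of_mem_boundary hx
  simp [hΦ.hasLinearTangentCone_iff hxΦ hx.1, h0]

theorem IsSurfaceWithBoundary.mem_boundary_iff (hM : IsSurfaceWithBoundary M) (hxM : x ∈ M) :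
    x ∈ boundary M ↔ ¬HasLinearTangentCone M x := by
  refine ⟨not_hasLinearTangentCone_of_mem_boundary, fun hlin => ?_⟩
  obtain ⟨Φ, hx, hΦ⟩ := hM x hxM
  rw [(hΦ.of_le (by simp)).hasLinearTangentCone_iff hx hxM, not_lt] at hlin
  exact ⟨hxM, Φ, hx, hΦ, hlin.antisymm ((hΦ.2 x hx).1 hxM).2⟩

theorem IsHalfPlaneChart.mem_boundary_iff (h : IsHalfPlaneChart 1 M Φ)
    (hM : IsSurfaceWithBoundary M) (hx : x ∈ Φ.source) (hxM : x ∈ M) :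
    x ∈ boundary M ↔ Φ x 1 = 0 := by
  rw [hM.mem_boundary_iff hxM, h.hasLinearTangentCone_iff hx hxM, not_lt]
  exact ⟨fun hle => hle.antisymm ((h.2 x hx).1 hxM).2, le_of_eq⟩

theorem IsHalfPlaneChart.eventually_notMem (h : IsHalfPlaneChart 1 M Φ) (hx : x ∈ Φ.source)
    (hxM : x ∉ M) : ∀ᶠ y in 𝓝 x, y ∉ M := by
  have hclosed : IsClosed {z : E3 | z 2 = 0 ∧ 0 ≤ z 1} :=
    (isClosed_eq (f := fun z : E3 => z 2) (by fun_prop) continuous_const).inter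
      (isClosed_le (g := fun z : E3 => z 1) continuous_const (by fun_prop))
  have hΦx : Φ x ∉ {z : E3 | z 2 = 0 ∧ 0 ≤ z 1} := fun hz => hxM ((h.2 x hx).2 hz)
  filter_upwards [(Φ.continuousAt hx).eventually_mem (hclosed.isOpen_compl.mem_nhds hΦx),
    Φ.open_source.mem_nhds hx] with y hy hys hyM using hy ((h.2 y hys).1 hyM)

theorem boundary_subset_closure_surfaceInterior (M : Set E3) :
    boundary M ⊆ closure (surfaceInterior M) := fun x hx => by
  obtain ⟨Φ, hxΦ, hΦ, h0⟩ := exists_chart_of_mem_boundary hx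
  have hcurve : Tendsto (fun t : ℝ => Φ.symm (Φ x + t • EuclideanSpace.single 1 1)) (𝓝[>] 0)
      (𝓝 x) := (Φ.tendsto_symm hxΦ).comp (tendsto_line (Φ x) _)
  refine mem_closure_of_tendsto hcurve ?_
  filter_upwards [eventually_line_mem_target hxΦ _, self_mem_nhdsWithin] with t ht (ht0 : 0 < t)
  have hs := Φ.map_target ht
  have hcoord := Φ.right_inv ht
  have hmem : Φ.symm (Φ x + t • EuclideanSpace.single 1 1) ∈ M := by
    refine (hΦ.2 _ hs).2 ?_
    rw [hcoord]
    simpa [h0, ((hΦ.2 x hxΦ).1 hx.1).1] using ht0.le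
  refine ⟨hmem, fun hb => not_hasLinearTangentCone_of_mem_boundary hb ?_⟩
  rw [hΦ.hasLinearTangentCone_iff hs hmem, hcoord]
  simpa [h0] using ht0

end Boundary

section InverseFunction

variable {Φ : OpenPartialHomeomorph E3 E3} {p : E3} {s : Set E3}

theorem exists_isDiffeoOn {n : WithTop ℕ∞} (hn0 : n ≠ 0) (hn : n ≠ ∞) {F : E3 → E3}
    (hs : s ∈ 𝓝 p) (hF : ContDiffAt ℝ n F p) (hinj : ∀ v, fderiv ℝ F p v = 0 → v = 0) :
    ∃ Θ : OpenPartialHomeomorph E3 E3, (Θ : E3 → E3) = F ∧ p ∈ Θ.source ∧ Θ.source ⊆ s ∧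
      IsDiffeoOn n Θ := by
  let L : E3 ≃L[ℝ] E3 := (LinearEquiv.ofInjectiveEndo (fderiv ℝ F p : E3 →ₗ[ℝ] E3)
    ((injective_iff_map_eq_zero _).2 hinj)).toContinuousLinearEquiv
  have hL : HasFDerivAt F (L : E3 →L[ℝ] E3) p := (hF.differentiableAt hn0).hasFDerivAt
  let Θ := hF.toOpenPartialHomeomorph F hL hn0
  have hΘ : (Θ : E3 → E3) = F := hF.toOpenPartialHomeomorph_coe hL hn0
  have hp : p ∈ Θ.source := hF.mem_toOpenPartialHomeomorph_source hL hn0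
  have hsymm : ContDiffAt ℝ n Θ.symm (Θ p) := by
    refine Θ.contDiffAt_symm (f₀' := L) (Θ.map_source hp) ?_ ?_ <;>
      rwa [Θ.left_inv hp, hΘ]
  obtain ⟨V, hV, hVo, hpV⟩ := mem_nhds_iff.1 (inter_mem hs ((hF.eventually hn).and
    ((Θ.continuousAt hp).eventually (hsymm.eventually hn))))
  refine ⟨Θ.restrOpen V hVo, hΘ, ⟨hp, hpV⟩, fun y hy => (hV hy.2).1, fun y hy => ?_,
    fun y hy => ?_⟩
  · exact (hΘ ▸ (hV hy.2).2.1 : ContDiffAt ℝ n Θ y).contDiffWithinAt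
  · have hy' := (hV ((Θ.restrOpen V hVo).map_target hy).2).2.2
    have hright : Θ ((Θ.restrOpen V hVo).symm y) = y := (Θ.restrOpen V hVo).right_inv hy
    exact (hright ▸ hy').contDiffWithinAt

theorem IsDiffeoOn.exists_replace_coord (h : IsDiffeoOn 1 Φ) (hp : p ∈ Φ.source) (hs : s ∈ 𝓝 p)
    {f : E3 → ℝ} (hf : ContDiffAt ℝ 1 f p) (i : Fin 3)
    (hfi : fderiv ℝ f p (coordVec Φ p i) ≠ 0) :
    ∃ Θ : OpenPartialHomeomorph E3 E3, p ∈ Θ.source ∧ Θ.source ⊆ s ∧ IsDiffeoOn 1 Θ ∧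
      ∀ x, Θ x i = f x ∧ ∀ j ≠ i, Θ x j = Φ x j := by
  let F : E3 → E3 := fun x => Φ x + (f x - Φ x i) • EuclideanSpace.single i 1
  have hFi : ∀ x, F x i = f x := fun x => by simp [F]
  have hFj : ∀ x, ∀ j ≠ i, F x j = Φ x j := fun x j hj => by simp [F, hj]
  have hF : ContDiffAt ℝ 1 F p := (h.contDiffAt hp).add
    ((hf.sub (contDiffAt_euclidean.1 (h.contDiffAt hp) i)).smul contDiffAt_const)
  have hdF : HasFDerivAt F (fderiv ℝ F p) p := (hF.differentiableAt one_ne_zero).hasFDerivAt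
  have hdFi : ∀ v, fderiv ℝ F p v i = fderiv ℝ f p v := fun v => by
    have hd := hasFDerivAt_coord hdF i
    simp only [hFi] at hd
    rw [hd.fderiv]
    rfl
  have hdFj : ∀ v, ∀ j ≠ i, fderiv ℝ F p v j = fderiv ℝ Φ p v j := fun v j hj => by
    have hd := hasFDerivAt_coord hdF j
    simp only [hFj _ j hj] at hd
    exact DFunLike.congr_fun (hd.unique (hasFDerivAt_coord (h.hasFDerivAt hp) j)) v
  obtain ⟨Θ, hΘF, hpΘ, hsub, hΘ⟩ := exists_isDiffeoOn one_ne_zero (by simp) hs hF fun v hv => by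
    have hv_eq : v = fderiv ℝ Φ p v i • coordVec Φ p i := by
      conv_lhs => rw [← h.sum_smul_coordVec hp v]
      exact Finset.sum_eq_single i (fun j _ hj => by simp [← hdFj v j hj, hv]) (by simp)
    have hfv : fderiv ℝ Φ p v i * fderiv ℝ f p (coordVec Φ p i) = 0 := by
      rw [← smul_eq_mul, ← map_smul, ← hv_eq, ← hdFi, hv, PiLp.zero_apply]
    rw [hv_eq, (mul_eq_zero.1 hfv).resolve_right hfi, zero_smul]
  exact ⟨Θ, hpΘ, hsub, hΘ, fun x => hΘF ▸ ⟨hFi x, hFj x⟩⟩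

end InverseFunction

section Subsurface

variable {M S T : Set E3} {Φ : OpenPartialHomeomorph E3 E3} {p : E3}

theorem IsHalfPlaneChart.exists_isPlaneChart (h : IsHalfPlaneChart 1 M Φ) (hp : p ∈ Φ.source)
    (hpM : p ∈ M) (hT : IsSurface 1 T) (hMT : M ⊆ T) :
    ∃ Θ : OpenPartialHomeomorph E3 E3, p ∈ Θ.source ∧ Θ.source ⊆ Φ.source ∧
      IsPlaneChart 1 T Θ ∧ ∀ x, ∀ j ≠ 2, Θ x j = Φ x j := by
  obtain ⟨Ψ, hpΨ, hΨ⟩ := hT p (hMT hpM)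
  have htransverse : fderiv ℝ (fun x => Ψ x 2) p (coordVec Φ p 2) ≠ 0 := fun h0 => by
    rw [(hasFDerivAt_coord (hΨ.1.hasFDerivAt hpΨ) 2).fderiv] at h0
    have htan : coordVec Φ p 2 ∈ tangentSpace M p := by
      rw [h.tangentSpace_eq hp hpM hT hMT]
      exact (hΨ.mem_tangentSpace_iff hpΨ (hMT hpM)).2 h0
    simpa [h.1.fderiv_coordVec hp] using (h.mem_tangentSpace_iff hp hpM).1 htan
  obtain ⟨Θ, hpΘ, hsub, hΘ, hcoord⟩ := h.1.exists_replace_coord hp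
    (inter_mem (Φ.open_source.mem_nhds hp) (Ψ.open_source.mem_nhds hpΨ))
    (contDiffAt_euclidean.1 (hΨ.1.contDiffAt hpΨ) 2) 2 htransverse
  refine ⟨Θ, hpΘ, hsub.trans inter_subset_left, ⟨hΘ, fun x hx => ?_⟩, fun x => (hcoord x).2⟩
  rw [(hcoord x).1]
  exact hΨ.2 x (hsub hx).2

theorem IsHalfPlaneChart.mem_nhdsWithin (h : IsHalfPlaneChart 1 M Φ) (hp : p ∈ Φ.source)
    (hpM : p ∈ M) (hpos : 0 < Φ p 1) (hT : IsSurface 1 T) (hMT : M ⊆ T) : M ∈ 𝓝[T] p := by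
  obtain ⟨Θ, hpΘ, hsub, hΘ, hcoord⟩ := h.exists_isPlaneChart hp hpM hT hMT
  let flatten : E3 → E3 := fun x => Φ x - Φ x 2 • EuclideanSpace.single 2 1
  have hcontinuous (i : Fin 3) : ContinuousAt (fun x => Φ x i) p :=
    (hasFDerivAt_coord (h.1.hasFDerivAt hp) i).continuousAt
  have hflatten : Tendsto flatten (𝓝 p) (𝓝 (Φ p)) := by
    have hflatten_p : flatten p = Φ p := by simp [flatten, ((h.2 p hp).1 hpM).1]
    rw [← hflatten_p]
    exact (Φ.continuousAt hp).sub ((hcontinuous 2).smul continuousAt_const)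
  have hsource : ∀ᶠ x in 𝓝 p, Φ.symm (flatten x) ∈ Θ.source :=
    ((Φ.tendsto_symm hp).comp hflatten).eventually_mem (Θ.open_source.mem_nhds hpΘ)
  -- `x ∈ T` and its projection `Φ.symm (flatten x) ∈ M ⊆ T` have the same image under `Θ`.
  rw [mem_nhdsWithin_iff_eventually]
  filter_upwards [hflatten.eventually_mem (Φ.open_target.mem_nhds (Φ.map_source hp)), hsource,
    Θ.open_source.mem_nhds hpΘ, (hcontinuous 1).eventually_const_lt hpos]
    with x htarget hy hx hx1 hxT
  have hΦy : Φ (Φ.symm (flatten x)) = flatten x := Φ.right_inv htarget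
  have hyM : Φ.symm (flatten x) ∈ M :=
    (h.2 _ (hsub hy)).2 (by simpa [hΦy, flatten] using hx1.le)
  have hΘy : Θ x = Θ (Φ.symm (flatten x)) := by
    ext j
    rcases eq_or_ne j 2 with rfl | hj
    · rw [(hΘ.2 _ hx).1 hxT, (hΘ.2 _ hy).1 (hMT hyM)]
    · rw [hcoord x j hj, hcoord _ j hj, hΦy]
      simp [flatten, hj]
  exact Θ.injOn hx hy hΘy ▸ hyM

theorem IsSurfaceWithBoundary.mem_nhdsWithin (hM : IsSurfaceWithBoundary M)
    (hp : p ∈ surfaceInterior M) (hT : IsSurface 1 T) (hMT : M ⊆ T) : M ∈ 𝓝[T] p := by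
  obtain ⟨Φ, hpΦ, hΦ⟩ := hM.exists_chart hp.1
  refine hΦ.mem_nhdsWithin hpΦ hp.1 ?_ hT hMT
  rw [← hΦ.hasLinearTangentCone_iff hpΦ hp.1, ← not_not (a := HasLinearTangentCone M p),
    ← hM.mem_boundary_iff hp.1]
  exact hp.2

theorem boundary_subset_boundary_diff (hT : IsSurface 1 T)
    (hM : IsSurfaceWithBoundary (T \ surfaceInterior S)) (hST : S ⊆ T) :
    boundary S ⊆ boundary (T \ surfaceInterior S) := fun p hp => by
  by_contra hpb
  have hnear : T \ surfaceInterior S ∈ 𝓝[surfaceInterior S] p :=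
    nhdsWithin_mono p (sdiff_subset.trans hST)
      (hM.mem_nhdsWithin ⟨⟨hST hp.1, fun hint => hint.2 hp⟩, hpb⟩ hT sdiff_subset)
  have := mem_closure_iff_nhdsWithin_neBot.1 (boundary_subset_closure_surfaceInterior S hp)
  obtain ⟨x, hx, hx'⟩ := Filter.nonempty_of_mem (inter_mem hnear self_mem_nhdsWithin)
  exact hx.2 hx'

theorem eventually_mem_boundary_of_mem_boundary_diff (hT : IsSurface 1 T) (hp : p ∈ boundary S) :
    ∀ᶠ x in 𝓝 p, x ∈ boundary (T \ surfaceInterior S) → x ∈ boundary S := by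
  obtain ⟨Φ, hpΦ, hΦ, -⟩ := exists_chart_of_mem_boundary hp
  filter_upwards [Φ.open_source.mem_nhds hpΦ] with x hx hxb
  by_contra hxS
  have hx_notMem : x ∉ S := fun h => hxb.1.2 ⟨h, hxS⟩
  have hnhds : 𝓝[T \ surfaceInterior S] x = 𝓝[T] x := by
    refine nhdsWithin_eq_iff_eventuallyEq.2 ?_
    filter_upwards [hΦ.eventually_notMem hx hx_notMem] with y hy
    exact propext ⟨fun h => h.1, fun h => ⟨h, fun hint => hy hint.1⟩⟩
  exact not_hasLinearTangentCone_of_mem_boundary hxb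
    ((hasLinearTangentCone_congr hnhds).2 (hT.hasLinearTangentCone hxb.1.1))

end Subsurface

section GaussMap

variable {M W : Set E3} {N : E3 → E3} {x v : E3}

theorem IsGaussMapOn.contDiffAt (hN : IsGaussMapOn M W N) (hW : IsOpen W) (hx : x ∈ W) :
    ContDiffAt ℝ ∞ N x :=
  hN.1.contDiffAt (hW.mem_nhds hx)

theorem IsGaussMapOn.hasFDerivAt (hN : IsGaussMapOn M W N) (hW : IsOpen W) (hx : x ∈ W) :
    HasFDerivAt N (fderiv ℝ N x) x :=
  ((hN.contDiffAt hW hx).differentiableAt (by simp)).hasFDerivAt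

theorem IsGaussMapOn.tangentSpace_eq (hN : IsGaussMapOn M W N) (hx : x ∈ M ∩ W)
    (hrank : Module.finrank ℝ (tangentSpace M x) = 2) :
    tangentSpace M x = (Submodule.span ℝ {N x})ᗮ :=
  eq_orthogonal_span_singleton (by simp) hrank (norm_ne_zero_iff.1 (by simp [(hN.2 x hx).1]))
    (hN.2 x hx).2

theorem IsGaussMapOn.eventually_norm_eq_one (hN : IsGaussMapOn M W N) (hW : IsOpen W)
    (hx : x ∈ W) : ∀ᶠ y in 𝓝[M] x, ‖N y‖ = 1 := by
  filter_upwards [self_mem_nhdsWithin, nhdsWithin_le_nhds (hW.mem_nhds hx)] with y hyM hyW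
  exact (hN.2 y ⟨hyM, hyW⟩).1

theorem IsGaussMapOn.fderiv_mem_tangentSpace (hN : IsGaussMapOn M W N) (hW : IsOpen W)
    (hx : x ∈ M ∩ W) (hrank : Module.finrank ℝ (tangentSpace M x) = 2)
    (hv : v ∈ tangentSpace M x) : fderiv ℝ N x v ∈ tangentSpace M x := by
  rw [hN.tangentSpace_eq hx hrank, Submodule.mem_orthogonal_singleton_iff_inner_right]
  exact inner_fderiv_apply_eq_zero_of_norm_eq (hN.hasFDerivAt hW hx.2)
    (hN.eventually_norm_eq_one hW hx.2) hx.1 hv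

theorem IsGaussMapOn.exists_fderiv_eq_zero (hN : IsGaussMapOn M W N) (hW : IsOpen W)
    (hx : x ∈ M ∩ W) (hrank : Module.finrank ℝ (tangentSpace M x) = 2)
    (hK : gaussianCurvature M N x = 0) : ∃ v ∈ tangentSpace M x, v ≠ 0 ∧ fderiv ℝ N x v = 0 := by
  obtain ⟨v, hv, hv0⟩ := (Submodule.ne_bot_iff _).1 (LinearMap.bot_lt_ker_of_det_eq_zero hK).ne'
  refine ⟨v, v.2, by simpa using hv0, ?_⟩
  have hself := Submodule.orthogonalProjectionOnto_mem_subspace_eq_self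
    (K := tangentSpace M x) ⟨_, hN.fderiv_mem_tangentSpace hW hx hrank v.2⟩
  have hproj : (tangentSpace M x).orthogonalProjectionOnto (fderiv ℝ N x v) = 0 := hv
  rw [hproj] at hself
  exact (congrArg Subtype.val hself).symm

theorem GaussMapImmersiveAlong.fderiv_ne_zero {M' c : Set E3} {p : E3}
    (hg : GaussMapImmersiveAlong M c) (hN : IsGaussMapOn M' W N) (hW : IsOpen W) (hp : p ∈ c ∩ W)
    (hc : c ⊆ M ∩ M') (htan : ∀ x ∈ c, tangentSpace M x = tangentSpace M' x)
    (hrank : ∀ x ∈ c, Module.finrank ℝ (tangentSpace M' x) = 2)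
    (hv : v ∈ tangentSpace c p) (hv0 : v ≠ 0) : fderiv ℝ N p v ≠ 0 := fun hNv => by
  obtain ⟨W₀, N₀, hW₀, hpW₀, hN₀, himm⟩ := hg p hp.1
  have hparallel : ∀ᶠ y in 𝓝[c] p, N₀ y ∈ Submodule.span ℝ {N y} := by
    filter_upwards [self_mem_nhdsWithin, nhdsWithin_le_nhds (hW.mem_nhds hp.2),
      nhdsWithin_le_nhds (hW₀.mem_nhds hpW₀)] with y hyc hyW hyW₀
    rw [← Submodule.orthogonal_orthogonal (Submodule.span ℝ {N y}),
      ← hN.tangentSpace_eq ⟨(hc hyc).2, hyW⟩ (hrank y hyc), ← htan y hyc,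
      hN₀.tangentSpace_eq ⟨(hc hyc).1, hyW₀⟩ (htan y hyc ▸ hrank y hyc)]
    exact Submodule.le_orthogonal_orthogonal _ (Submodule.mem_span_singleton_self _)
  exact himm v hv hv0 <| fderiv_apply_eq_zero_of_mem_span_singleton
    (hN₀.hasFDerivAt hW₀ hpW₀) (hN.hasFDerivAt hW hp.2)
    (nhdsWithin_mono p (hc.trans inter_subset_left) (hN₀.eventually_norm_eq_one hW₀ hpW₀))
    (nhdsWithin_mono p (hc.trans inter_subset_right) (hN.eventually_norm_eq_one hW hp.2))
    hparallel hp.1 hv hNv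

end GaussMap

section AdaptedChart

variable {M W s : Set E3} {N : E3 → E3} {Φ Θ : OpenPartialHomeomorph E3 E3} {p x w : E3}

theorem IsSurfaceWithBoundary.finrank_tangentSpace (hM : IsSurfaceWithBoundary M) (hx : x ∈ M) :
    Module.finrank ℝ (tangentSpace M x) = 2 := by
  obtain ⟨Φ, hxΦ, hΦ⟩ := hM.exists_chart hx
  exact hΦ.finrank_tangentSpace hxΦ hx

theorem IsHalfPlaneChart.coordVec_zero_mem_tangentSpace_boundary (h : IsHalfPlaneChart 1 M Φ)
    (hM : IsSurfaceWithBoundary M) (hp : p ∈ Φ.source) (hpb : p ∈ boundary M) :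
    coordVec Φ p 0 ∈ tangentSpace (boundary M) p := by
  refine posTangentConeAt_subset_tangentSpace _ _ <|
    h.1.fderiv_symm_mem_posTangentConeAt hp <| .of_forall fun t y hy hty => ?_
  have hy2 : Φ y 2 = 0 := by simp [hty, ((h.2 p hp).1 hpb.1).1]
  have hy1 : Φ y 1 = 0 := by simp [hty, (h.mem_boundary_iff hM hp hpb.1).1 hpb]
  exact (h.mem_boundary_iff hM hy ((h.2 y hy).2 ⟨hy2, hy1.ge⟩)).2 hy1

theorem exists_isHalfPlaneChart_coord_zero_eq_inner (hM : IsSurfaceWithBoundary M)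
    (hp : p ∈ boundary M) (hN : ContDiffAt ℝ 1 N p)
    (himm : ∀ v ∈ tangentSpace (boundary M) p, v ≠ 0 → fderiv ℝ N p v ≠ 0) (hs : s ∈ 𝓝 p) :
    ∃ (Θ : OpenPartialHomeomorph E3 E3) (w : E3), p ∈ Θ.source ∧ Θ.source ⊆ s ∧
      IsHalfPlaneChart 1 M Θ ∧ ∀ x, Θ x 0 = inner ℝ w (N x) := by
  obtain ⟨Φ, hpΦ, hΦ⟩ := hM.exists_chart hp.1
  have hcoordVec : coordVec Φ p 0 ≠ 0 := fun h0 => by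
    simpa [h0] using congrArg (fun v : E3 => v 0) (hΦ.1.fderiv_coordVec hpΦ 0)
  let w := fderiv ℝ N p (coordVec Φ p 0)
  have hw : w ≠ 0 := himm _ (hΦ.coordVec_zero_mem_tangentSpace_boundary hM hpΦ hp) hcoordVec
  have hd : HasFDerivAt (fun x => inner ℝ w (N x)) (innerSL ℝ w ∘L fderiv ℝ N p) p :=
    (innerSL ℝ w).hasFDerivAt.comp p (hN.differentiableAt one_ne_zero).hasFDerivAt
  have hdw : fderiv ℝ (fun x => inner ℝ w (N x)) p (coordVec Φ p 0) ≠ 0 := by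
    rw [hd.fderiv]
    exact inner_self_ne_zero.2 hw
  obtain ⟨Θ, hpΘ, hsub, hΘ, hcoord⟩ := hΦ.1.exists_replace_coord hpΦ
    (inter_mem hs (Φ.open_source.mem_nhds hpΦ)) (contDiffAt_const.inner ℝ hN) 0 hdw
  refine ⟨Θ, w, hpΘ, hsub.trans inter_subset_left, ⟨hΘ, fun x hx => ?_⟩, fun x => (hcoord x).1⟩
  rw [(hcoord x).2 1 (by decide), (hcoord x).2 2 (by decide)]
  exact hΦ.2 x (hsub hx).2

theorem IsGaussMapOn.fderiv_coordVec_one_eq_zero (hN : IsGaussMapOn M W N) (hW : IsOpen W)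
    (hK : gaussianCurvature M N x = 0) (hΘ : IsHalfPlaneChart 1 M Θ) (hx : x ∈ Θ.source)
    (hxM : x ∈ M ∩ W) (hw : ∀ y, Θ y 0 = inner ℝ w (N y)) :
    fderiv ℝ N x (coordVec Θ x 1) = 0 := by
  obtain ⟨v, hv, hv0, hNv⟩ := hN.exists_fderiv_eq_zero hW hxM
    (hΘ.finrank_tangentSpace hx hxM.1) hK
  have hv2 : fderiv ℝ Θ x v 2 = 0 := (hΘ.mem_tangentSpace_iff hx hxM.1).1 hv
  have hv0' : fderiv ℝ Θ x v 0 = 0 := by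
    have hd := hasFDerivAt_coord (hΘ.1.hasFDerivAt hx) 0
    simp only [hw] at hd
    have hd' := (innerSL ℝ w).hasFDerivAt.comp x (hN.hasFDerivAt hW hxM.2)
    simpa [hNv] using DFunLike.congr_fun (hd.unique hd') v
  have hv_eq : v = fderiv ℝ Θ x v 1 • coordVec Θ x 1 := by
    conv_lhs => rw [← hΘ.1.sum_smul_coordVec hx v]
    simp [Fin.sum_univ_three, hv0', hv2]
  rw [hv_eq, map_smul] at hNv
  exact (smul_eq_zero.1 hNv).resolve_left fun h1 => hv0 (by rw [hv_eq, h1, zero_smul])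

end AdaptedChart

section ProjectiveTangentSpace

variable {M M' W : Set E3} {N : E3 → E3} {x y : E3}

theorem span_pair_sup_map_inr_le {V : Submodule ℝ E3} (h : x - y ∈ V) :
    Submodule.span ℝ {((1 : ℝ), x)} ⊔ V.map (LinearMap.inr ℝ ℝ E3) ≤
      Submodule.span ℝ {((1 : ℝ), y)} ⊔ V.map (LinearMap.inr ℝ ℝ E3) := by
  refine sup_le ?_ le_sup_right
  rw [Submodule.span_singleton_le_iff_mem,
    show ((1 : ℝ), x) = (1, y) + LinearMap.inr ℝ ℝ E3 (x - y) by simp]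
  exact Submodule.add_mem_sup (Submodule.mem_span_singleton_self _) (Submodule.mem_map_of_mem h)

theorem projectiveTangentSpace_eq (h : tangentSpace M x = tangentSpace M' y)
    (hxy : x - y ∈ tangentSpace M x) :
    projectiveTangentSpace M x = projectiveTangentSpace M' y := by
  rw [projectiveTangentSpace, projectiveTangentSpace, ← h]
  exact le_antisymm (span_pair_sup_map_inr_le hxy)
    (span_pair_sup_map_inr_le (by simpa using neg_mem hxy))

theorem projectiveTangentSpace_inter_of_isOpen {V : Set E3} (hV : IsOpen V) (hx : x ∈ V) :
    projectiveTangentSpace (V ∩ M) x = projectiveTangentSpace M x :=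
  projectiveTangentSpace_eq
    (tangentSpace_congr (nhdsWithin_inter_of_mem (nhdsWithin_le_nhds (hV.mem_nhds hx)))) (by simp)

theorem IsGaussMapOn.projectiveTangentSpace_eq (hN : IsGaussMapOn M W N)
    (hM : IsSurfaceWithBoundary M) (hx : x ∈ M ∩ W) (hy : y ∈ M ∩ W) (hxy : N x = N y)
    (horth : inner ℝ (N x) (x - y) = 0) :
    projectiveTangentSpace M x = projectiveTangentSpace M y := by
  have hx' := hN.tangentSpace_eq hx (hM.finrank_tangentSpace hx.1)
  have hy' := hN.tangentSpace_eq hy (hM.finrank_tangentSpace hy.1)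
  refine FlatExtension.projectiveTangentSpace_eq (by rw [hx', hy', hxy]) ?_
  rwa [hx', Submodule.mem_orthogonal_singleton_iff_inner_right]

theorem eq_of_hasDerivAt_zero {E : Type*} [NormedAddCommGroup E] [NormedSpace ℝ E] {f : ℝ → E}
    {a b : ℝ} (hab : a ≤ b) (hf : ∀ t ∈ Icc a b, HasDerivAt f 0 t) : f b = f a :=
  constant_of_has_deriv_right_zero (fun t ht => (hf t ht).continuousAt.continuousWithinAt)
    (fun t ht => (hf t (Ico_subset_Icc_self ht)).hasDerivWithinAt) b (right_mem_Icc.2 hab)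

theorem IsGaussMapOn.projectiveTangentSpace_eq_of_hasDerivAt (hN : IsGaussMapOn M W N)
    (hW : IsOpen W) (hM : IsSurfaceWithBoundary M) {q q' : ℝ → E3} {a b : ℝ} (hab : a ≤ b)
    (hq : ∀ t ∈ Icc a b, q t ∈ M ∩ W) (hd : ∀ t ∈ Icc a b, HasDerivAt q (q' t) t)
    (htan : ∀ t ∈ Icc a b, q' t ∈ tangentSpace M (q t))
    (hker : ∀ t ∈ Icc a b, fderiv ℝ N (q t) (q' t) = 0) :
    projectiveTangentSpace M (q b) = projectiveTangentSpace M (q a) := by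
  have hNq : ∀ t ∈ Icc a b, HasDerivAt (fun t => N (q t)) 0 t := fun t ht =>
    hker t ht ▸ (hN.hasFDerivAt hW (hq t ht).2).comp_hasDerivAt t (hd t ht)
  have hconst : ∀ t ∈ Icc a b, N (q b) = N (q t) := fun t ht =>
    eq_of_hasDerivAt_zero ht.2 fun u hu => hNq u ⟨ht.1.trans hu.1, hu.2⟩
  have hheight : ∀ t ∈ Icc a b, HasDerivAt (fun t => inner ℝ (N (q b)) (q t)) 0 t := by
    intro t ht
    have horth : inner ℝ (N (q b)) (q' t) = 0 :=
      hconst t ht ▸ (hN.2 _ (hq t ht)).2 _ (htan t ht)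
    rw [← horth]
    exact (innerSL ℝ (N (q b))).hasFDerivAt.comp_hasDerivAt t (hd t ht)
  refine hN.projectiveTangentSpace_eq hM (hq b (right_mem_Icc.2 hab)) (hq a (left_mem_Icc.2 hab))
    (hconst a (left_mem_Icc.2 hab)) ?_
  rw [inner_sub_right, sub_eq_zero]
  exact eq_of_hasDerivAt_zero hab hheight

end ProjectiveTangentSpace

section FlatSurface

variable {M W s : Set E3} {N : E3 → E3} {Θ : OpenPartialHomeomorph E3 E3} {p z w : E3} {b : ℝ}

theorem projectiveTangentSpace_eq_along_line (hM : IsSurfaceWithBoundary M) (hW : IsOpen W)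
    (hN : IsGaussMapOn M W N) (hK : ∀ x ∈ M ∩ W, gaussianCurvature M N x = 0)
    (hΘ : IsHalfPlaneChart 1 M Θ) (hsub : Θ.source ⊆ W) (hw : ∀ x, Θ x 0 = inner ℝ w (N x))
    (hz1 : z 1 = 0) (hz2 : z 2 = 0) (hb : 0 ≤ b)
    (hline : ∀ t ∈ Icc 0 b, z + t • EuclideanSpace.single 1 1 ∈ Θ.target) :
    projectiveTangentSpace M (Θ.symm (z + b • EuclideanSpace.single 1 1)) =
      projectiveTangentSpace M (Θ.symm z) := by
  let q : ℝ → E3 := fun t => Θ.symm (z + t • EuclideanSpace.single 1 1)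
  have hsource : ∀ t ∈ Icc 0 b, q t ∈ Θ.source := fun t ht => Θ.map_target (hline t ht)
  have hΘq : ∀ t ∈ Icc 0 b, Θ (q t) = z + t • EuclideanSpace.single 1 1 :=
    fun t ht => Θ.right_inv (hline t ht)
  have hqM : ∀ t ∈ Icc 0 b, q t ∈ M := fun t ht =>
    (hΘ.2 _ (hsource t ht)).2 (by simpa [hΘq t ht, hz1, hz2] using ht.1)
  have hd : ∀ t ∈ Icc 0 b, HasDerivAt q (coordVec Θ (q t) 1) t := fun t ht => by
    have hd_line : HasDerivAt (fun t : ℝ => z + t • (EuclideanSpace.single 1 1 : E3))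
        (EuclideanSpace.single 1 1) t := by
      simpa using ((hasDerivAt_id t).smul_const (EuclideanSpace.single 1 1 : E3)).const_add z
    have hd_symm := hΘ.1.hasFDerivAt_symm (hsource t ht)
    rw [hΘq t ht] at hd_symm
    rw [coordVec, hΘq t ht]
    exact hd_symm.comp_hasDerivAt t hd_line
  have hq0 : q 0 = Θ.symm z := by simp [q]
  have hqW : ∀ t ∈ Icc 0 b, q t ∈ M ∩ W := fun t ht => ⟨hqM t ht, hsub (hsource t ht)⟩
  have htan : ∀ t ∈ Icc 0 b, coordVec Θ (q t) 1 ∈ tangentSpace M (q t) := fun t ht => by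
    rw [hΘ.mem_tangentSpace_iff (hsource t ht) (hqM t ht), hΘ.1.fderiv_coordVec (hsource t ht)]
    simp
  rw [← hq0]
  exact hN.projectiveTangentSpace_eq_of_hasDerivAt (q := q) (q' := fun t => coordVec Θ (q t) 1)
    hW hM hb hqW hd htan fun t ht =>
      hN.fderiv_coordVec_one_eq_zero hW (hK _ (hqW t ht)) hΘ (hsource t ht) (hqW t ht) hw

theorem sub_smul_single_add_smul_single_mem_ball {ι : Type*} [Fintype ι] [DecidableEq ι]
    {c x : EuclideanSpace ℝ ι} {r : ℝ} {i : ι} (hc : c i = 0) (hx : x ∈ Metric.ball c r) {t : ℝ}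
    (ht : t ∈ Icc 0 (x i)) :
    x - x i • EuclideanSpace.single i 1 + t • EuclideanSpace.single i 1 ∈ Metric.ball c r := by
  rw [Metric.mem_ball] at hx ⊢
  refine lt_of_le_of_lt ?_ hx
  rw [EuclideanSpace.dist_eq, EuclideanSpace.dist_eq]
  refine Real.sqrt_le_sqrt (Finset.sum_le_sum fun j _ => ?_)
  rcases eq_or_ne j i with rfl | hj
  · simpa [Real.dist_eq, hc] using pow_le_pow_left₀ ht.1 ht.2 2
  · simp [hj]

theorem exists_isOpen_projectiveTangentSpace_eq_boundary (hM : IsSurfaceWithBoundary M)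
    (hp : p ∈ boundary M) (hW : IsOpen W) (hpW : p ∈ W) (hN : IsGaussMapOn M W N)
    (hK : ∀ x ∈ M ∩ W, gaussianCurvature M N x = 0)
    (himm : ∀ v ∈ tangentSpace (boundary M) p, v ≠ 0 → fderiv ℝ N p v ≠ 0) (hs : s ∈ 𝓝 p) :
    ∃ V, IsOpen V ∧ p ∈ V ∧ V ⊆ s ∧ ∀ x ∈ V ∩ M, ∃ y ∈ V ∩ boundary M,
      projectiveTangentSpace M x = projectiveTangentSpace M y := by
  obtain ⟨Θ, w, hpΘ, hsub, hΘ, hw⟩ := exists_isHalfPlaneChart_coord_zero_eq_inner hM hp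
    ((hN.contDiffAt hW hpW).of_le (by simp)) himm (inter_mem hs (hW.mem_nhds hpW))
  have hp1 : Θ p 1 = 0 := (hΘ.mem_boundary_iff hM hpΘ hp.1).1 hp
  obtain ⟨r, hr, hball⟩ := Metric.isOpen_iff.1 Θ.open_target _ (Θ.map_source hpΘ)
  refine ⟨Θ.source ∩ Θ ⁻¹' Metric.ball (Θ p) r, Θ.isOpen_inter_preimage Metric.isOpen_ball,
    ⟨hpΘ, mem_preimage.2 (Metric.mem_ball_self hr)⟩, fun x hx => (hsub hx.1).1, ?_⟩
  rintro x ⟨⟨hx, hxr⟩, hxM⟩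
  obtain ⟨hx2, hx1⟩ := (hΘ.2 x hx).1 hxM
  set z : E3 := Θ x - Θ x 1 • EuclideanSpace.single 1 1 with hz_def
  have hz_add : z + Θ x 1 • EuclideanSpace.single 1 1 = Θ x := by simp [hz_def]
  have hz1 : z 1 = 0 := by simp [hz_def]
  have hz2 : z 2 = 0 := by simp [hz_def, hx2]
  have hline : ∀ t ∈ Icc 0 (Θ x 1), z + t • EuclideanSpace.single 1 1 ∈ Metric.ball (Θ p) r :=
    fun t ht => sub_smul_single_add_smul_single_mem_ball hp1 (mem_preimage.1 hxr) ht
  have hz : z ∈ Metric.ball (Θ p) r := by simpa using hline 0 ⟨le_rfl, hx1⟩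
  have hy : Θ.symm z ∈ Θ.source := Θ.map_target (hball hz)
  have hΘy : Θ (Θ.symm z) = z := Θ.right_inv (hball hz)
  have hyV : Θ.symm z ∈ Θ ⁻¹' Metric.ball (Θ p) r := mem_preimage.2 (hΘy.symm ▸ hz)
  have hyM : Θ.symm z ∈ M := (hΘ.2 _ hy).2 (hΘy.symm ▸ ⟨hz2, hz1.ge⟩)
  have hyb : Θ.symm z ∈ boundary M := (hΘ.mem_boundary_iff hM hy hyM).2 (hΘy.symm ▸ hz1)
  refine ⟨Θ.symm z, ⟨⟨hy, hyV⟩, hyb⟩, ?_⟩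
  have hconst := projectiveTangentSpace_eq_along_line hM hW hN hK hΘ
    (hsub.trans inter_subset_right) hw hz1 hz2 hx1 fun t ht => hball (hline t ht)
  rwa [hz_add, Θ.left_inv hx] at hconst

end FlatSurface

section LegendreLift

variable {M : Set E3} {x : E3}

theorem affinePoint_injective : Function.Injective affinePoint := fun x y h => by
  obtain ⟨a, ha⟩ := (Projectivization.mk_eq_mk_iff' ℝ _ _ _ _).1 h
  obtain ⟨rfl, rfl⟩ : a = 1 ∧ a • y = x := by simpa using ha
  exact one_smul ℝ y

theorem exists_incidence {Y : RP3Dual} (h : LinearMap.ker Y.rep = projectiveTangentSpace M x) :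
    ∃ z : Incidence, proj₁ z = affinePoint x ∧ proj₂ z = Y := by
  have hmem : ((1 : ℝ), x) ∈ LinearMap.ker Y.rep :=
    h ▸ Submodule.mem_sup_left (Submodule.mem_span_singleton_self _)
  obtain ⟨a, ha⟩ := Projectivization.exists_smul_eq_mk_rep ℝ ((1 : ℝ), x)
    fun h => one_ne_zero (congrArg Prod.fst h)
  refine ⟨⟨(affinePoint x, Y), ?_⟩, rfl, rfl⟩
  rw [affinePoint, ← ha, Units.smul_def, map_smul, LinearMap.mem_ker.1 hmem, smul_zero]

theorem proj₂_image_legendreLift (M : Set E3) :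
    proj₂ '' legendreLift M = {Y | ∃ x ∈ M, LinearMap.ker Y.rep = projectiveTangentSpace M x} := by
  ext Y
  constructor
  · rintro ⟨z, ⟨x, hx, -, hz⟩, rfl⟩
    exact ⟨x, hx, hz⟩
  · rintro ⟨x, hx, hY⟩
    obtain ⟨z, hz, rfl⟩ := exists_incidence hY
    exact ⟨z, ⟨x, hx, hz, hY⟩, rfl⟩

theorem proj₂_image_boundaryLift_over (S U : Set E3) :
    proj₂ '' {z ∈ boundaryLift S | proj₁ z ∈ affinePoint '' U} =
      {Y | ∃ y ∈ boundary S ∩ U, LinearMap.ker Y.rep = projectiveTangentSpace S y} := by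
  ext Y
  constructor
  · rintro ⟨z, ⟨⟨⟨y, -, hy, hz⟩, hb⟩, hU⟩, rfl⟩
    rw [hy, affinePoint_injective.mem_set_image] at hb hU
    exact ⟨y, ⟨hb, hU⟩, hz⟩
  · rintro ⟨y, ⟨hb, hU⟩, hY⟩
    obtain ⟨z, hz, rfl⟩ := exists_incidence hY
    exact ⟨z, ⟨⟨⟨y, hb.1, hz, hY⟩, y, hb, hz.symm⟩, y, hU, hz.symm⟩, rfl⟩

end LegendreLift

section FlatC1Extension

variable {S T : Set E3} {p : E3}

theorem IsFlatC1Extension.boundary_subset (h : IsFlatC1Extension S T) :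
    boundary S ⊆ boundary (T \ surfaceInterior S) :=
  boundary_subset_boundary_diff h.surface h.smooth h.subset

theorem IsFlatC1Extension.nhdsWithin_boundary_eq (h : IsFlatC1Extension S T)
    (hp : p ∈ boundary S) : 𝓝[boundary (T \ surfaceInterior S)] p = 𝓝[boundary S] p := by
  refine le_antisymm (nhdsWithin_le_iff.2 ?_) (nhdsWithin_mono p h.boundary_subset)
  exact mem_nhdsWithin_iff_eventually.2 (eventually_mem_boundary_of_mem_boundary_diff h.surface hp)

theorem IsFlatC1Extension.tangentSpace_eq (h : IsFlatC1Extension S T) (hp : p ∈ boundary S) :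
    tangentSpace S p = tangentSpace (T \ surfaceInterior S) p := by
  obtain ⟨Φ, hpΦ, hΦ, -⟩ := exists_chart_of_mem_boundary hp
  obtain ⟨Ψ, hpΨ, hΨ, -⟩ := exists_chart_of_mem_boundary (h.boundary_subset hp)
  rw [hΦ.tangentSpace_eq hpΦ hp.1 h.surface h.subset,
    hΨ.tangentSpace_eq hpΨ (h.boundary_subset hp).1 h.surface sdiff_subset]

theorem IsFlatC1Extension.exists_isOpen_projectiveTangentSpace_eq (h : IsFlatC1Extension S T)
    (hg : GaussMapImmersiveAlong S (boundary S)) (hp : p ∈ boundary S) :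
    ∃ V, IsOpen V ∧ p ∈ V ∧ ∀ x ∈ V ∩ (T \ surfaceInterior S), ∃ y ∈ V ∩ boundary S,
      projectiveTangentSpace (T \ surfaceInterior S) x = projectiveTangentSpace S y := by
  obtain ⟨W, N, hW, hpW, hN, hK⟩ := h.flat p (h.boundary_subset hp).1
  obtain ⟨V, hV, hpV, hVs, hVM⟩ := exists_isOpen_projectiveTangentSpace_eq_boundary h.smooth
    (h.boundary_subset hp) hW hpW hN hK
    (fun v hv hv0 => hg.fderiv_ne_zero hN hW ⟨hp, hpW⟩
      (fun x hx => ⟨hx.1, (h.boundary_subset hx).1⟩) (fun x => h.tangentSpace_eq)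
      (fun x hx => h.smooth.finrank_tangentSpace (h.boundary_subset hx).1)
      (tangentSpace_congr (h.nhdsWithin_boundary_eq hp) ▸ hv) hv0)
    (eventually_mem_boundary_of_mem_boundary_diff h.surface hp)
  refine ⟨V, hV, hpV, fun x hx => ?_⟩
  obtain ⟨y, ⟨hyV, hyb⟩, hxy⟩ := hVM x hx
  have hyS : y ∈ boundary S := hVs hyV hyb
  exact ⟨y, ⟨hyV, hyS⟩,
    hxy.trans (projectiveTangentSpace_eq (h.tangentSpace_eq hyS).symm (by simp))⟩

end FlatC1Extension

end FlatExtension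

open FlatExtension

theorem mainTheorem10_general (S T : Set E3) (hT : IsFlatC1Extension S T)
    (hg : GaussMapImmersiveAlong S (boundary S)) :
    ∀ p ∈ boundary S, ∃ U : Set E3, p ∈ U ∧
      (∃ W : Set E3, IsOpen W ∧ U = W ∩ (T \ surfaceInterior S)) ∧
      proj₂ '' legendreLift U ⊆ dualBoundary S ∧
      proj₂ '' legendreLift U =
        proj₂ '' {z ∈ boundaryLift S | proj₁ z ∈ affinePoint '' U} := by
  intro p hp
  obtain ⟨V, hV, hpV, hVS⟩ := hT.exists_isOpen_projectiveTangentSpace_eq hg hp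
  have hbM : boundary S ⊆ T \ surfaceInterior S := fun y hy => (hT.boundary_subset hy).1
  have himage : proj₂ '' legendreLift (V ∩ (T \ surfaceInterior S)) =
      proj₂ '' {z ∈ boundaryLift S |
        proj₁ z ∈ affinePoint '' (V ∩ (T \ surfaceInterior S))} := by
    rw [proj₂_image_legendreLift, proj₂_image_boundaryLift_over]
    ext Y
    constructor
    · rintro ⟨x, hx, hY⟩
      obtain ⟨y, ⟨hyV, hyS⟩, hxy⟩ := hVS x hx
      refine ⟨y, ⟨hyS, hyV, hbM hyS⟩, ?_⟩
      rw [hY, projectiveTangentSpace_inter_of_isOpen hV hx.1, hxy]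
    · rintro ⟨y, ⟨hyS, hy⟩, hY⟩
      refine ⟨y, hy, ?_⟩
      rw [hY, projectiveTangentSpace_inter_of_isOpen hV hy.1,
        projectiveTangentSpace_eq (hT.tangentSpace_eq hyS) (by simp)]
  refine ⟨V ∩ (T \ surfaceInterior S), ⟨hpV, hbM hp⟩, ⟨V, hV, rfl⟩, ?_, himage⟩
  rw [himage]
  exact image_mono fun z hz => hz.1

theorem mainTheorem10 (S T : Set FlatExtension.E3)
    (hS : FlatExtension.IsSurfaceWithBoundary S)
    (hT : FlatExtension.IsFlatC1Extension S T)
    (hg : FlatExtension.GaussMapImmersiveAlong S (FlatExtension.boundary S)) :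
    ∀ p ∈ FlatExtension.boundary S, ∃ U : Set FlatExtension.E3,
      p ∈ U ∧
      (∃ W : Set FlatExtension.E3, IsOpen W ∧
        U = W ∩ (T \ FlatExtension.surfaceInterior S)) ∧
      FlatExtension.proj₂ '' FlatExtension.legendreLift U ⊆ FlatExtension.dualBoundary S ∧
      FlatExtension.proj₂ '' FlatExtension.legendreLift U =
        FlatExtension.proj₂ '' {z ∈ FlatExtension.boundaryLift S |
          FlatExtension.proj₁ z ∈ FlatExtension.affinePoint '' U} :=
  mainTheorem10_general S T hT hg
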